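/- Throughout, a closed orientable surface is a compact, connected, orientable 2-dimensional manifold without boundary, and a periodic map on a space $F$ is a homeomorphism $f:F\to F$ with $f^n=\mathrm{id}_F$ for some integer $n\ge 1$. Let $\langle f\rangle$ be the finite cyclic group of homeomorphisms of $F$ generated by $f$. A topological embedding $e:F\to\mathbb R^m$ is called $f$-equivariant if there is a group homomorphism $\tilde\rho:\langle f\rangle\to SO(m)$ such that $e\circ g=\tilde\rho(g)\circ e$ for every $g\in\langle f\rangle$. For every integer $m>0$ there are a closed orientable surface $F$ and a periodic map $f$ on $F$ such that there is no $f$-equivariant embedding $e:F\to\mathbb R^m$. -/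

import Mathlib

open scoped Manifold ContDiff

/-- The charts of the given atlas of `F`, with values in the Euclidean plane, are compatible with
one orientation: every transition map has positive Jacobian determinant at every point of its
domain. -/
def HasOrientedAtlas (F : Type*) [TopologicalSpace F]
    [ChartedSpace (EuclideanSpace ℝ (Fin 2)) F] : Prop :=
  ∀ e ∈ atlas (EuclideanSpace ℝ (Fin 2)) F, ∀ e' ∈ atlas (EuclideanSpace ℝ (Fin 2)) F,
    ∀ x ∈ (e.symm.trans e').source,
      0 < (fderiv ℝ (e.symm.trans e') x).det

/-- `F` is a closed orientable surface: a connected compact Hausdorff space which has an oriented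
smooth atlas whose charts are homeomorphisms from open sets of `F` onto open sets of the plane (so
`F` has no boundary; second countability follows from compactness). -/
structure IsClosedOrientableSurface (F : Type*) [TopologicalSpace F] : Prop where
  t2 : T2Space F
  compact : CompactSpace F
  connected : ConnectedSpace F
  exists_orientedAtlas : ∃ _ : ChartedSpace (EuclideanSpace ℝ (Fin 2)) F,
    IsManifold (𝓡 2) ∞ F ∧ HasOrientedAtlas F

/-- `f` is periodic: some positive power of `f` is the identity. -/
def IsPeriodicMap {M : Type*} [TopologicalSpace M] (f : M ≃ₜ M) : Prop :=
  ∃ n : ℕ, 0 < n ∧ f ^ n = 1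

/-- For an action `ρ` of `G` on `M` by homeomorphisms, the map `e : M → ℝᵐ` is a `G`-equivariant
embedding: it is a topological embedding, and there is a representation `ρ' : G → SO(m)` such that
`e ∘ ρ g = ρ' g ∘ e` for every `g`. -/
def IsEquivariantEmbedding {G M : Type*} [Group G] [TopologicalSpace M] (ρ : G →* (M ≃ₜ M))
    {m : ℕ} (e : M → EuclideanSpace ℝ (Fin m)) : Prop :=
  Topology.IsEmbedding e ∧
    ∃ ρ' : G →* Matrix.specialOrthogonalGroup (Fin m) ℝ,
      ∀ (g : G) (x : M),
        e (ρ g x) = Matrix.toEuclideanLin (ρ' g : Matrix (Fin m) (Fin m) ℝ) (e x)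

/-- `e` is an `f`-equivariant embedding: it is equivariant for the action on `M` of the cyclic group
of homeomorphisms generated by `f`. -/
def IsEquivariantEmbeddingFor {M : Type*} [TopologicalSpace M] (f : M ≃ₜ M)
    {m : ℕ} (e : M → EuclideanSpace ℝ (Fin m)) : Prop :=
  IsEquivariantEmbedding (Subgroup.zpowers f).subtype e

/-!
The length of a divisibility chain of periods of a map bounds from below the dimension of a space in
which the map is linearized. Let `f` have points `p 0, …, p n` such that `p i` has minimal period
`2 ^ i`. If `e` is an equivariant embedding into `ℝᵐ` and `R` is the linear map by which `f` acts,
then the fixed spaces of `R ^ (2 ^ i)`, `i = 0, …, n`, increase with `i`, and strictly, since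
`e (p (i + 1))` lies in the next one but not in the current one (`e` is injective). Hence `n ≤ m`
(`IsEquivariantEmbeddingFor.le_of_periods`), and a closed orientable surface is needed for each `k`
with a periodic map having minimal periods `1, 2, 4, …, 2 ^ (k - 1)`.

Such a surface is a branched cyclic cover of the sphere, given by a tower of square roots. Over the
points `(u, h)` of the unit sphere of `ℂ × ℝ`, `TowerSurface k` consists of the `(z₀, …, z_k)` with
`z₀ = u` and `z_{j+1}² = z_j (u - c_j)`, for distinct nonzero `c_j` in the open unit disc. The map
`towerRotation k` multiplies `z_j` by `exp (2πi / 2^j)`. Over `u = c_i` the coordinates `z_j` with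
`j ≤ i` are nonzero and the others vanish, so that such points have minimal period `2 ^ i`
(`towerRotation_pow_eq_self`, `towerRotation_pow_ne_self`).

* The surface is a regular level set (`towerMap_regular`): at a point where some `z_j` vanishes,
  `z_k` is a local coordinate; elsewhere a coordinate of the sphere is. A two-dimensional
  regular level set has an oriented smooth atlas (`exists_orientedAtlas_levelSet`), by the inverse
  function theorem.
* It is bounded, hence compact, as `|z_j| ≤ 2` by induction on `j`.
* It is connected: the radial segment from `u` to `0` lifts to the cover, since an affine path
  `t ↦ a + b t` in `ℂ` has continuous `2^n`-th roots, even through zero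
  (`exists_continuous_sqrtSequence`). As the rotation permutes each fibre over the sphere
  transitively, every point is joined in this way to one of the points `h = ±1`, `z = 0`, and a
  point with `h = 0` is joined to both.
-/

/-! ### Oriented smooth atlases on regular level sets -/

/-- The determinant of a block triangular endomorphism of a product whose first diagonal block is
the identity is the determinant of the second diagonal block. -/
theorem LinearMap.det_of_fst_eq {R W P : Type*} [CommRing R] [AddCommGroup W] [Module R W]
    [AddCommGroup P] [Module R P] [Module.Free R W] [Module.Finite R W] [Module.Free R P]
    [Module.Finite R P] (L : W × P →ₗ[R] W × P) (hL : ∀ x, (L x).1 = x.1) :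
    LinearMap.det L =
      LinearMap.det (LinearMap.snd R W P ∘ₗ L ∘ₗ LinearMap.inr R W P) := by
  classical
  let b := Module.Free.chooseBasis R W
  let b' := Module.Free.chooseBasis R P
  rw [← LinearMap.det_toMatrix (b.prod b'), ← LinearMap.det_toMatrix b']
  have : LinearMap.toMatrix (b.prod b') (b.prod b') L = Matrix.fromBlocks 1 0
      (LinearMap.toMatrix b b' (LinearMap.snd R W P ∘ₗ L ∘ₗ LinearMap.inl R W P))
      (LinearMap.toMatrix b' b' (LinearMap.snd R W P ∘ₗ L ∘ₗ LinearMap.inr R W P)) := by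
    ext i j
    rcases i with i | i <;> rcases j with j | j <;>
      simp [LinearMap.toMatrix_apply, hL, Matrix.one_apply, Finsupp.single_apply, eq_comm]
  rw [this, Matrix.det_fromBlocks_zero₁₂, Matrix.det_one, one_mul]

section LevelSet

variable {E W P : Type*} [NormedAddCommGroup E] [NormedSpace ℝ E] [NormedAddCommGroup W]
  [NormedSpace ℝ W] [NormedAddCommGroup P] [NormedSpace ℝ P]

/-- A local diffeomorphism `Ψ` which straightens the level sets of `Φ`: its first component is `Φ`,
and it preserves the orientations, where those of `E` and `W × P` are identified by means of the
linear isomorphism `A`. The function underlying `Ψ` is required to be smooth on all of `E`. -/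
structure IsAdapted (Φ : E → W) (A : E ≃L[ℝ] W × P) (Ψ : OpenPartialHomeomorph E (W × P)) :
    Prop where
  fst_eq : ∀ x, (Ψ x).1 = Φ x
  contDiff : ContDiff ℝ ∞ Ψ
  det_pos : ∀ x ∈ Ψ.source, 0 < ((fderiv ℝ Ψ x).comp (A.symm : W × P →L[ℝ] E)).det

/-- `e` is the chart of the level set `Φ = 0` which is given by the second component of the
straightening diffeomorphism `Ψ`. -/
structure IsSliceChart (Φ : E → W) (A : E ≃L[ℝ] W × P)
    (e : OpenPartialHomeomorph {x // Φ x = 0} P) (Ψ : OpenPartialHomeomorph E (W × P)) :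
    Prop where
  adapted : IsAdapted Φ A Ψ
  mem_source : ∀ q ∈ e.source, (q : E) ∈ Ψ.source
  apply_eq : ∀ q, e q = (Ψ q).2
  mem_target : ∀ y ∈ e.target, (0, y) ∈ Ψ.target
  symm_eq : ∀ y ∈ e.target, (e.symm y : E) = Ψ.symm (0, y)

theorem exists_isSliceChart {Φ : E → W} {A : E ≃L[ℝ] W × P} {Ψ : OpenPartialHomeomorph E (W × P)}
    (hΨ : IsAdapted Φ A Ψ) (p : {x // Φ x = 0}) (hp : (p : E) ∈ Ψ.source) :
    ∃ e, p ∈ e.source ∧ IsSliceChart Φ A e Ψ := by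
  classical
  have key : ∀ y, (0, y) ∈ Ψ.target → Φ (Ψ.symm (0, y)) = 0 := fun y hy ↦ by
    rw [← hΨ.fst_eq, Ψ.right_inv hy]
  have hq : ∀ q : {x // Φ x = 0}, ((0 : W), (Ψ q).2) = Ψ q := fun q ↦ by
    ext <;> simp [hΨ.fst_eq, q.2]
  -- The value `p` off the target is arbitrary.
  let g : P → {x // Φ x = 0} := fun y ↦
    if h : Φ (Ψ.symm (0, y)) = 0 then ⟨Ψ.symm (0, y), h⟩ else p
  have hg : ∀ y, (0, y) ∈ Ψ.target → (g y : E) = Ψ.symm (0, y) := fun y hy ↦ by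
    simp only [g]; rw [dif_pos (key y hy)]
  let e : OpenPartialHomeomorph {x // Φ x = 0} P :=
    { toFun := fun q ↦ (Ψ q).2
      invFun := g
      source := Subtype.val ⁻¹' Ψ.source
      target := {y | (0, y) ∈ Ψ.target}
      map_source' := fun q hqs ↦ by
        simp only [Set.mem_ofPred_eq, hq]
        exact Ψ.map_source hqs
      map_target' := fun y hy ↦ by
        simp only [Set.mem_preimage, hg y hy]
        exact Ψ.map_target hy
      left_inv' := fun q hqs ↦ by
        apply Subtype.ext
        rw [hg, hq, Ψ.left_inv hqs]
        rw [hq]; exact Ψ.map_source hqs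
      right_inv' := fun y hy ↦ by
        rw [hg y hy, Ψ.right_inv hy]
      open_source := Ψ.open_source.preimage continuous_subtype_val
      open_target := Ψ.open_target.preimage (by fun_prop)
      continuousOn_toFun :=
        (hΨ.contDiff.continuous.comp continuous_subtype_val).snd.continuousOn
      continuousOn_invFun := by
        refine (Topology.IsInducing.continuousOn_iff (f := g) Topology.IsInducing.subtypeVal).2 ?_
        have : ContinuousOn (fun y : P ↦ Ψ.symm (0, y)) {y | (0, y) ∈ Ψ.target} :=
          Ψ.continuousOn_symm.comp (by fun_prop) (fun y hy ↦ hy)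
        exact this.congr fun y hy ↦ hg y hy }
  exact ⟨e, hp, hΨ, fun q h ↦ h, fun q ↦ rfl, fun y h ↦ h, hg⟩

/-- Transitions between slice charts are smooth and preserve the orientation: the composition of one
straightening diffeomorphism with the inverse of another has positive Jacobian determinant and
preserves the first component, so its derivative is block triangular. -/
theorem IsSliceChart.contDiffAt_transition_and_det_pos [FiniteDimensional ℝ E]
    [FiniteDimensional ℝ W] [FiniteDimensional ℝ P] {Φ : E → W} {A : E ≃L[ℝ] W × P}
    {e e' : OpenPartialHomeomorph {x // Φ x = 0} P} {Ψ Ψ' : OpenPartialHomeomorph E (W × P)}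
    (he : IsSliceChart Φ A e Ψ) (he' : IsSliceChart Φ A e' Ψ') {y : P}
    (hy : y ∈ (e.symm.trans e').source) :
    ContDiffAt ℝ ∞ (e.symm.trans e') y ∧ 0 < (fderiv ℝ (e.symm.trans e') y).det := by
  have hyt : y ∈ e.target := by
    rw [OpenPartialHomeomorph.trans_source] at hy; exact hy.1
  have hys : e.symm y ∈ e'.source := by
    rw [OpenPartialHomeomorph.trans_source] at hy; exact hy.2
  have heq : (e.symm.trans e' : P → P) =ᶠ[nhds y] fun v ↦ (Ψ' (Ψ.symm (0, v))).2 := by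
    filter_upwards [e.open_target.mem_nhds hyt] with v hv
    rw [OpenPartialHomeomorph.coe_trans, Function.comp_apply, he'.apply_eq, he.symm_eq v hv]
  set x := Ψ.symm (0, y) with hx
  have hxs : x ∈ Ψ.source := Ψ.map_target (he.mem_target y hyt)
  have hxs' : x ∈ Ψ'.source := by
    rw [hx, ← he.symm_eq y hyt]; exact he'.mem_source _ hys
  have hd := he.adapted.det_pos x hxs
  have hd' := he'.adapted.det_pos x hxs'
  set N := (fderiv ℝ Ψ x).comp (A.symm : W × P →L[ℝ] E) with hN
  set N' := (fderiv ℝ Ψ' x).comp (A.symm : W × P →L[ℝ] E) with hN'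
  let Ne := N.toContinuousLinearEquivOfDetNeZero hd.ne'
  let M : E ≃L[ℝ] W × P := A.trans Ne
  have hΨd : HasFDerivAt Ψ (M : E →L[ℝ] W × P) x := by
    have h1 := (he.adapted.contDiff.differentiable (by simp) x).hasFDerivAt
    have h2 : (M : E →L[ℝ] W × P) = fderiv ℝ Ψ x := by
      refine ContinuousLinearMap.ext fun v ↦ ?_
      change N (A v) = _
      simp [hN]
    rwa [h2]
  have hΨ'd := (he'.adapted.contDiff.differentiable (by simp) x).hasFDerivAt
  -- The first components agree, as both are the derivative of `Φ`.
  have hfst : ∀ v, (N v).1 = (N' v).1 := by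
    intro v
    have h1 := (he.adapted.contDiff.differentiable (by simp) x).hasFDerivAt.fst
    have h2 := hΨ'd.fst
    have h3 : (fun x ↦ (Ψ x).1) = fun x ↦ (Ψ' x).1 := by
      ext1 z; rw [he.adapted.fst_eq, he'.adapted.fst_eq]
    rw [h3] at h1
    exact congrArg (fun l : E →L[ℝ] W ↦ l (A.symm v)) (h1.unique h2)
  have hsymm := Ψ.hasFDerivAt_symm (he.mem_target y hyt) hΨd
  have hinr : HasFDerivAt (fun v : P ↦ ((0 : W), v)) (ContinuousLinearMap.inr ℝ W P) y :=
    (ContinuousLinearMap.inr ℝ W P).hasFDerivAt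
  have hT := (hΨ'd.comp (f := fun v ↦ Ψ.symm (0, v)) y (hsymm.comp y hinr)).snd
  constructor
  · refine ContDiffAt.congr_of_eventuallyEq ?_ heq
    have hs : ContDiffAt ℝ ∞ Ψ.symm (0, y) :=
      Ψ.contDiffAt_symm (he.mem_target y hyt) hΨd he.adapted.contDiff.contDiffAt
    exact (he'.adapted.contDiff.contDiffAt.comp y
      (hs.comp y (contDiffAt_const.prodMk contDiffAt_id))).snd
  · rw [heq.fderiv_eq]
    have hT' := hT.fderiv
    simp only [Function.comp_def] at hT'
    rw [hT']
    let L : W × P →ₗ[ℝ] W × P := (N' : W × P →ₗ[ℝ] W × P) ∘ₗ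
      (Ne.symm.toLinearEquiv : W × P →ₗ[ℝ] W × P)
    have hL1 : ∀ v, (L v).1 = v.1 := by
      intro v
      change (N' (Ne.symm v)).1 = v.1
      rw [← hfst]
      exact congrArg Prod.fst (Ne.apply_symm_apply v)
    have hdetL : 0 < LinearMap.det L := by
      have hmul : LinearMap.det L * LinearMap.det (N : W × P →ₗ[ℝ] W × P) =
          LinearMap.det (N' : W × P →ₗ[ℝ] W × P) := by
        rw [← LinearMap.det_comp]
        congr 1
        refine LinearMap.ext fun v ↦ ?_
        exact congrArg N' (Ne.symm_apply_apply v)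
      have hd2 : 0 < LinearMap.det (N : W × P →ₗ[ℝ] W × P) := hd
      have hd2' : 0 < LinearMap.det (N' : W × P →ₗ[ℝ] W × P) := hd'
      rw [← hmul] at hd2'
      exact pos_of_mul_pos_left hd2' hd2.le
    rw [LinearMap.det_of_fst_eq L hL1] at hdetL
    exact hdetL

/-- If `(dΦ, π)` is injective at `p` for some linear map `π`, then `(Φ, π)` or `(Φ, ρ ∘ π)`, where
`ρ` reverses the orientation of `P`, is a straightening diffeomorphism near `p`. -/
theorem exists_isAdapted [FiniteDimensional ℝ E] [FiniteDimensional ℝ W] [FiniteDimensional ℝ P]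
    {Φ : E → W} (hΦ : ContDiff ℝ ∞ Φ) (A : E ≃L[ℝ] W × P) {ρ : P →L[ℝ] P} (hρ : ρ.det = -1)
    {p : E} (hreg : ∃ π : E →L[ℝ] P, ∀ v, fderiv ℝ Φ p v = 0 → π v = 0 → v = 0) :
    ∃ Ψ, IsAdapted Φ A Ψ ∧ p ∈ Ψ.source := by
  obtain ⟨π, hπ⟩ : ∃ π : E →L[ℝ] P,
      0 < (((fderiv ℝ Φ p).prod π).comp (A.symm : W × P →L[ℝ] E)).det := by
    obtain ⟨π, hπ⟩ := hreg
    set N := ((fderiv ℝ Φ p).prod π).comp (A.symm : W × P →L[ℝ] E) with hN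
    -- `N` is an injective endomorphism of a finite-dimensional space.
    have hdet : N.det ≠ 0 := by
      have hinj : LinearMap.ker (N : W × P →ₗ[ℝ] W × P) = ⊥ := by
        refine LinearMap.ker_eq_bot'.2 fun v hv ↦ ?_
        have h1 := congrArg Prod.fst hv
        have h2 := congrArg Prod.snd hv
        exact A.symm.map_eq_zero_iff.1 (hπ _ h1 h2)
      exact (LinearEquiv.ofInjectiveEndo _ (LinearMap.ker_eq_bot.1 hinj)).isUnit_det'.ne_zero
    rcases hdet.lt_or_gt with h | h
    · refine ⟨ρ.comp π, ?_⟩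
      let L : W × P →ₗ[ℝ] W × P := LinearMap.prodMap LinearMap.id (ρ : P →ₗ[ℝ] P)
      have hL : LinearMap.det L = -1 := by
        rw [LinearMap.det_prodMap, LinearMap.det_id, one_mul]; exact hρ
      have hcomp : ((((fderiv ℝ Φ p).prod (ρ.comp π)).comp (A.symm : W × P →L[ℝ] E) :
          W × P →L[ℝ] W × P) : W × P →ₗ[ℝ] W × P) = L ∘ₗ (N : W × P →ₗ[ℝ] W × P) := rfl
      have hneg : LinearMap.det (N : W × P →ₗ[ℝ] W × P) < 0 := h
      change 0 < LinearMap.det _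
      rw [hcomp, LinearMap.det_comp, hL]
      linarith
    · exact ⟨π, h⟩
  set g : E → W × P := fun x ↦ (Φ x, π x) with hg
  have hgc : ContDiff ℝ ∞ g := hΦ.prodMk π.contDiff
  have hgd : fderiv ℝ g p = (fderiv ℝ Φ p).prod π :=
    ((hΦ.differentiable (by simp) p).hasFDerivAt.prodMk π.hasFDerivAt).fderiv
  let U : Set E := {x | 0 < ((fderiv ℝ g x).comp (A.symm : W × P →L[ℝ] E)).det}
  have hU : IsOpen U := by
    have h1 : Continuous (fderiv ℝ g) := hgc.continuous_fderiv (by simp)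
    exact isOpen_lt continuous_const
      (ContinuousLinearMap.continuous_det.comp (h1.clm_comp continuous_const))
  have hpU : p ∈ U := by
    simp only [U, Set.mem_ofPred_eq, hgd]; exact hπ
  let Ne := ContinuousLinearMap.toContinuousLinearEquivOfDetNeZero _ hπ.ne'
  let M : E ≃L[ℝ] W × P := A.trans Ne
  have hM : HasFDerivAt g (M : E →L[ℝ] W × P) p := by
    have h2 : (M : E →L[ℝ] W × P) = fderiv ℝ g p := by
      refine ContinuousLinearMap.ext fun v ↦ ?_
      rw [hgd]
      change ((fderiv ℝ Φ p).prod π) (A.symm (A v)) = _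
      rw [A.symm_apply_apply]
    rw [h2]
    exact (hgc.differentiable (by simp) p).hasFDerivAt
  let Ψ := hgc.contDiffAt.toOpenPartialHomeomorph g hM (by simp)
  have hpΨ : p ∈ Ψ.source := ContDiffAt.mem_toOpenPartialHomeomorph_source _ hM (by simp)
  exact ⟨Ψ.restrOpen U hU, ⟨fun x ↦ rfl, hgc, fun x hx ↦ hx.2⟩, hpΨ, hpU⟩

/-- A regular level set of dimension two has an oriented smooth atlas. Regularity at `x` is
expressed by a linear map `π` to the plane which is injective on the kernel of the derivative; as this kernel
has dimension at least two, the derivative is then surjective. -/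
theorem exists_orientedAtlas_levelSet [FiniteDimensional ℝ E] [FiniteDimensional ℝ W]
    {Φ : E → W} (hΦ : ContDiff ℝ ∞ Φ)
    (hdim : Module.finrank ℝ E = Module.finrank ℝ W + 2)
    (hreg : ∀ x, Φ x = 0 → ∃ π : E →L[ℝ] EuclideanSpace ℝ (Fin 2),
      ∀ v, fderiv ℝ Φ x v = 0 → π v = 0 → v = 0) :
    ∃ _ : ChartedSpace (EuclideanSpace ℝ (Fin 2)) {x // Φ x = 0},
      IsManifold (𝓡 2) ∞ {x // Φ x = 0} ∧ HasOrientedAtlas {x // Φ x = 0} := by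
  have A : E ≃L[ℝ] W × EuclideanSpace ℝ (Fin 2) :=
    ContinuousLinearEquiv.ofFinrankEq (by simp [hdim])
  obtain ⟨ρ, hρ⟩ : ∃ ρ : EuclideanSpace ℝ (Fin 2) →L[ℝ] EuclideanSpace ℝ (Fin 2),
      ρ.det = -1 := by
    refine ⟨LinearMap.toContinuousLinearMap
      (Matrix.toLin (EuclideanSpace.basisFun (Fin 2) ℝ).toBasis
        (EuclideanSpace.basisFun (Fin 2) ℝ).toBasis (Matrix.diagonal ![1, -1])), ?_⟩
    rw [LinearMap.det_toContinuousLinearMap, LinearMap.det_toLin, Matrix.det_diagonal]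
    simp
  choose Ψ hΨ hmem using fun p : {x // Φ x = 0} ↦ exists_isAdapted hΦ A hρ (hreg p p.2)
  choose e he hse using fun p : {x // Φ x = 0} ↦ exists_isSliceChart (hΨ p) p (hmem p)
  let cs : ChartedSpace (EuclideanSpace ℝ (Fin 2)) {x // Φ x = 0} :=
    { atlas := Set.range e
      chartAt := e
      mem_chart_source := he
      chart_mem_atlas := fun p ↦ ⟨p, rfl⟩ }
  refine ⟨cs, ?_, ?_⟩
  · refine isManifold_of_contDiffOn _ _ _ ?_
    rintro _ _ ⟨p, rfl⟩ ⟨q, rfl⟩ y hy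
    have hy' : y ∈ ((e p).symm.trans (e q)).source := by simpa using hy
    exact ((hse p).contDiffAt_transition_and_det_pos (hse q) hy').1.contDiffWithinAt
  · rintro _ ⟨p, rfl⟩ _ ⟨q, rfl⟩ y hy
    exact ((hse p).contDiffAt_transition_and_det_pos (hse q) hy).2

end LevelSet

/-! ### The tower of square roots -/

/-- The branch points `c_j = (j + 1) / (k + 1)`; for `j < k` they lie in the open unit disc. -/
noncomputable def branchPoint (k j : ℕ) : ℂ := ((j + 1) / (k + 1) : ℝ)

theorem branchPoint_injective (k : ℕ) : Function.Injective (branchPoint k) := by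
  intro i j h
  have hk : ((k : ℝ) + 1) ≠ 0 := by positivity
  have h' : ((i : ℝ) + 1) / (k + 1) = (j + 1) / (k + 1) := Complex.ofReal_injective h
  rw [div_left_inj' hk] at h'
  exact_mod_cast add_right_cancel h'

theorem branchPoint_ne_zero (k j : ℕ) : branchPoint k j ≠ 0 := by
  rw [branchPoint, Complex.ofReal_ne_zero]
  positivity

theorem normSq_branchPoint_lt_one {k j : ℕ} (h : j < k) :
    Complex.normSq (branchPoint k j) < 1 := by
  rw [branchPoint, Complex.normSq_ofReal]
  have h0 : (0 : ℝ) ≤ (j + 1) / (k + 1) := by positivity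
  have h1 : ((j : ℝ) + 1) / (k + 1) < 1 := by
    rw [div_lt_one (by positivity)]
    exact_mod_cast Nat.succ_lt_succ h
  nlinarith

/-- The equations `z_{j+1}² = z_j (z₀ - c_j)` of the branched cover of the plane, whose projection
is the coordinate `z₀`. -/
def IsSqrtTower (k : ℕ) (z : Fin (k + 1) → ℂ) : Prop :=
  ∀ j : Fin k, z j.succ ^ 2 = z j.castSucc * (z 0 - branchPoint k j)

/-- The map whose zero set is the tower surface: the equation of the unit sphere for the point
`(z₀, h)`, where `h = x.1` and `z = x.2`, and the equations of the tower of square roots. -/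
noncomputable def towerMap (k : ℕ) (x : ℝ × (Fin (k + 1) → ℂ)) : ℝ × (Fin k → ℂ) :=
  (Complex.normSq (x.2 0) + x.1 ^ 2 - 1,
    fun j ↦ x.2 j.succ ^ 2 - x.2 j.castSucc * (x.2 0 - branchPoint k j))

theorem towerMap_eq_zero_iff {k : ℕ} {x : ℝ × (Fin (k + 1) → ℂ)} :
    towerMap k x = 0 ↔ Complex.normSq (x.2 0) + x.1 ^ 2 = 1 ∧ IsSqrtTower k x.2 := by
  simp only [towerMap, Prod.mk_eq_zero, funext_iff, Pi.zero_apply, sub_eq_zero, IsSqrtTower]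

/-- The branched cover of the unit sphere in `ℂ × ℝ` obtained from the tower of square roots. -/
abbrev TowerSurface (k : ℕ) : Type := {x : ℝ × (Fin (k + 1) → ℂ) // towerMap k x = 0}

namespace IsSqrtTower

variable {k : ℕ} {z : Fin (k + 1) → ℂ}

theorem eq_zero_or_eq_branchPoint (hz : IsSqrtTower k z) {j : Fin (k + 1)} (hj : z j = 0) :
    z 0 = 0 ∨ ∃ l : Fin k, (l : ℕ) < j ∧ z 0 = branchPoint k l := by
  induction j using Fin.induction with
  | zero => exact Or.inl hj
  | succ i ih =>
    have h := hz i
    rw [hj, zero_pow two_ne_zero, eq_comm, mul_eq_zero, sub_eq_zero] at h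
    rcases h with h | h
    · rcases ih h with h | ⟨l, hl, h⟩
      · exact Or.inl h
      · exact Or.inr ⟨l, hl.trans (by simp), h⟩
    · exact Or.inr ⟨i, by simp, h⟩

theorem normSq_lt_one (hz : IsSqrtTower k z) {j : Fin (k + 1)} (hj : z j = 0) :
    Complex.normSq (z 0) < 1 := by
  rcases hz.eq_zero_or_eq_branchPoint hj with h | ⟨l, -, h⟩
  · simp [h]
  · rw [h]; exact normSq_branchPoint_lt_one l.2

theorem ne_branchPoint (hz : IsSqrtTower k z) {j : Fin k} (hj : z j.castSucc = 0) :
    z 0 ≠ branchPoint k j := by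
  intro h0
  rcases hz.eq_zero_or_eq_branchPoint hj with h | ⟨l, hl, h⟩
  · exact branchPoint_ne_zero k j (h0.symm.trans h)
  · have := branchPoint_injective k (h0.symm.trans h)
    simp [this] at hl

theorem eq_zero_of_lt (hz : IsSqrtTower k z) {i : Fin k} (hi : z 0 = branchPoint k i)
    {j : Fin (k + 1)} (hj : (i : ℕ) < j) : z j = 0 := by
  induction j using Fin.induction with
  | zero => simp at hj
  | succ l ih =>
    have h := hz l
    rcases (Nat.lt_succ_iff_lt_or_eq.1 hj : (i : ℕ) < l ∨ (i : ℕ) = l) with hl | hl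
    · rw [ih hl, zero_mul] at h
      exact pow_eq_zero_iff two_ne_zero |>.1 h
    · rw [hi, hl, sub_self, mul_zero] at h
      exact pow_eq_zero_iff two_ne_zero |>.1 h

theorem ne_zero_of_le (hz : IsSqrtTower k z) {i : Fin k} (hi : z 0 = branchPoint k i)
    {j : Fin (k + 1)} (hj : (j : ℕ) ≤ i) : z j ≠ 0 := by
  intro h0
  rcases hz.eq_zero_or_eq_branchPoint h0 with h | ⟨l, hl, h⟩
  · exact branchPoint_ne_zero k i (hi.symm.trans h)
  · have := branchPoint_injective k (hi.symm.trans h)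
    omega

theorem eq_zero_of_zero (hz : IsSqrtTower k z) (h0 : z 0 = 0) : z = 0 := by
  funext j
  induction j using Fin.induction with
  | zero => exact h0
  | succ i ih =>
    have h := hz i
    rw [ih, Pi.zero_apply, zero_mul] at h
    exact pow_eq_zero_iff two_ne_zero |>.1 h

theorem norm_le_two (hz : IsSqrtTower k z) (h0 : ‖z 0‖ ≤ 1) (j : Fin (k + 1)) : ‖z j‖ ≤ 2 := by
  induction j using Fin.induction with
  | zero => linarith
  | succ i ih =>
    have h := congrArg norm (hz i)
    rw [norm_pow, norm_mul] at h
    have hb : ‖branchPoint k i‖ ≤ 1 := by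
      have := (normSq_branchPoint_lt_one i.2).le
      rw [Complex.normSq_eq_norm_sq] at this
      exact (sq_le_one_iff₀ (norm_nonneg _)).1 this
    have h2 : ‖z 0 - branchPoint k i‖ ≤ 2 := (norm_sub_le _ _).trans (by linarith)
    have h4 : ‖z i.succ‖ ^ 2 ≤ 2 * 2 := by
      rw [h]; exact mul_le_mul ih h2 (norm_nonneg _) zero_le_two
    exact abs_le_of_sq_le_sq' (by linarith) zero_le_two |>.2

variable {dz : Fin (k + 1) → ℂ}

/-- The hypothesis `hd` says that `dz` is tangent to the curve of all towers of square roots. -/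
theorem tangent_eq_zero (hd : ∀ j : Fin k, 2 * z j.succ * dz j.succ =
      dz j.castSucc * (z 0 - branchPoint k j) + z j.castSucc * dz 0)
    (h0 : dz 0 = 0) (hzero : ∀ j, z j = 0 → dz j = 0) : dz = 0 := by
  funext j
  induction j using Fin.induction with
  | zero => exact h0
  | succ i ih =>
    by_cases hi : z i.succ = 0
    · exact hzero _ hi
    · have h := hd i
      rw [ih, h0, Pi.zero_apply, zero_mul, mul_zero, add_zero, mul_eq_zero] at h
      exact h.resolve_left (mul_ne_zero two_ne_zero hi)

/-- Where some coordinate vanishes, the last coordinate is a local coordinate of the curve. -/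
theorem tangent_eq_zero_of_last (hz : IsSqrtTower k z)
    (hd : ∀ j : Fin k, 2 * z j.succ * dz j.succ =
      dz j.castSucc * (z 0 - branchPoint k j) + z j.castSucc * dz 0)
    (hj : ∃ j, z j = 0) (hlast : dz (Fin.last k) = 0) : dz = 0 := by
  have hzero : ∀ j, z j = 0 → dz j = 0 := by
    intro j
    induction j using Fin.lastCases with
    | last => exact fun _ ↦ hlast
    | cast i =>
      intro hi
      have hs : z i.succ = 0 := by
        have h := hz i
        rw [hi, zero_mul] at h
        exact pow_eq_zero_iff two_ne_zero |>.1 h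
      have h := hd i
      rw [hs, hi, mul_zero, zero_mul, zero_mul, add_zero, eq_comm, mul_eq_zero] at h
      exact h.resolve_right (sub_ne_zero.2 (hz.ne_branchPoint hi))
  refine tangent_eq_zero hd ?_ hzero
  obtain ⟨j, hj⟩ := hj
  rcases hz.eq_zero_or_eq_branchPoint hj with h | ⟨l, -, h⟩
  · exact hzero 0 h
  · have h1 := hd l
    rw [hz.eq_zero_of_lt h (j := l.succ) (by simp), h, sub_self, mul_zero, mul_zero, zero_mul,
      zero_add, eq_comm, mul_eq_zero] at h1
    exact h1.resolve_left (hz.ne_zero_of_le h (by simp))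

end IsSqrtTower

/-! ### The tower surface is a regular level set -/

theorem contDiff_towerMap (k : ℕ) : ContDiff ℝ ∞ (towerMap k) := by
  have hc : ∀ j : Fin (k + 1), ContDiff ℝ ∞ fun x : ℝ × (Fin (k + 1) → ℂ) ↦ x.2 j :=
    fun j ↦ contDiff_pi.1 contDiff_snd j
  refine ContDiff.prodMk ?_ (contDiff_pi.2 fun j ↦ ?_)
  · have hre : ContDiff ℝ ∞ fun x : ℝ × (Fin (k + 1) → ℂ) ↦ (x.2 0).re :=
      Complex.reCLM.contDiff.comp (hc 0)
    have him : ContDiff ℝ ∞ fun x : ℝ × (Fin (k + 1) → ℂ) ↦ (x.2 0).im :=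
      Complex.imCLM.contDiff.comp (hc 0)
    simp only [Complex.normSq_apply]
    exact (((hre.mul hre).add (him.mul him)).add (contDiff_fst.pow 2)).sub contDiff_const
  · exact ((hc _).pow 2).sub ((hc _).mul ((hc 0).sub contDiff_const))

/-- The derivative of `towerMap`, computed along the line `t ↦ x + t v`. -/
theorem fderiv_towerMap_apply (k : ℕ) (x v : ℝ × (Fin (k + 1) → ℂ)) :
    fderiv ℝ (towerMap k) x v =
      (2 * ((x.2 0).re * (v.2 0).re + (x.2 0).im * (v.2 0).im + x.1 * v.1),
        fun j : Fin k ↦ 2 * x.2 j.succ * v.2 j.succ -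
          (v.2 j.castSucc * (x.2 0 - branchPoint k j) + x.2 j.castSucc * v.2 0)) := by
  have hΦ : HasFDerivAt (towerMap k) (fderiv ℝ (towerMap k) x) (x + (0 : ℝ) • v) := by
    rw [zero_smul, add_zero]
    exact ((contDiff_towerMap k).differentiable (by simp) x).hasFDerivAt
  have hline : HasDerivAt (fun t : ℝ ↦ x + t • v) v 0 := by
    simpa using ((hasDerivAt_id (0 : ℝ)).smul_const v).const_add x
  refine (hΦ.comp_hasDerivAt (0 : ℝ) hline).unique ?_
  have hz : ∀ j, HasDerivAt (fun t : ℝ ↦ (x + t • v).2 j) (v.2 j) 0 := fun j ↦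
    hasDerivAt_pi.1 hline.snd j
  have hre : HasDerivAt (fun t : ℝ ↦ ((x + t • v).2 0).re) (v.2 0).re 0 :=
    Complex.reCLM.hasFDerivAt.comp_hasDerivAt (0 : ℝ) (hz 0)
  have him : HasDerivAt (fun t : ℝ ↦ ((x + t • v).2 0).im) (v.2 0).im 0 :=
    Complex.imCLM.hasFDerivAt.comp_hasDerivAt (0 : ℝ) (hz 0)
  have hh : HasDerivAt (fun t : ℝ ↦ (x + t • v).1) v.1 0 :=
    (ContinuousLinearMap.fst ℝ ℝ (Fin (k + 1) → ℂ)).hasFDerivAt.comp_hasDerivAt (0 : ℝ) hline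
  refine HasDerivAt.prodMk ?_ (hasDerivAt_pi.2 fun j ↦ ?_)
  · simp only [Complex.normSq_apply]
    convert! (((hre.mul hre).add (him.mul him)).add (hh.pow 2)).sub_const 1 using 1
    simp
    ring
  · convert! ((hz j.succ).pow 2).sub
      ((hz j.castSucc).mul ((hz 0).sub_const (branchPoint k j))) using 1
    simp

/-- Local coordinates of the tower surface: `z_k` where some `z_j` vanishes, and else `z₀` if
`h ≠ 0`, and the angle of `z₀` together with `h` if `h = 0`. -/
theorem towerMap_regular (k : ℕ) {x : ℝ × (Fin (k + 1) → ℂ)} (hx : towerMap k x = 0) :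
    ∃ π : ℝ × (Fin (k + 1) → ℂ) →L[ℝ] ℂ,
      ∀ v, fderiv ℝ (towerMap k) x v = 0 → π v = 0 → v = 0 := by
  obtain ⟨hsph, hz⟩ := towerMap_eq_zero_iff.1 hx
  let coord (j : Fin (k + 1)) : ℝ × (Fin (k + 1) → ℂ) →L[ℝ] ℂ :=
    (ContinuousLinearMap.proj j).comp (ContinuousLinearMap.snd ℝ ℝ (Fin (k + 1) → ℂ))
  have htan : ∀ v, fderiv ℝ (towerMap k) x v = 0 →
      (x.2 0).re * (v.2 0).re + (x.2 0).im * (v.2 0).im + x.1 * v.1 = 0 ∧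
      ∀ j : Fin k, 2 * x.2 j.succ * v.2 j.succ =
        v.2 j.castSucc * (x.2 0 - branchPoint k j) + x.2 j.castSucc * v.2 0 := by
    intro v hv
    rw [fderiv_towerMap_apply, Prod.mk_eq_zero] at hv
    refine ⟨by linarith [hv.1], fun j ↦ ?_⟩
    exact sub_eq_zero.1 (congrFun hv.2 j)
  by_cases hram : ∃ j, x.2 j = 0
  · refine ⟨coord (Fin.last k), fun v hv hπ ↦ ?_⟩
    obtain ⟨h1, h2⟩ := htan v hv
    have hv2 : v.2 = 0 := hz.tangent_eq_zero_of_last h2 hram hπ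
    obtain ⟨j, hj⟩ := hram
    have hh : x.1 ≠ 0 := by
      intro h
      have := hz.normSq_lt_one hj
      rw [h] at hsph
      linarith
    refine Prod.ext ?_ hv2
    simpa [hv2, hh] using h1
  push Not at hram
  by_cases hh : x.1 = 0
  · refine ⟨Complex.ofRealCLM.comp ((x.2 0).re • Complex.imCLM.comp (coord 0) -
      (x.2 0).im • Complex.reCLM.comp (coord 0)) +
      Complex.I • Complex.ofRealCLM.comp (ContinuousLinearMap.fst ℝ ℝ (Fin (k + 1) → ℂ)),
      fun v hv hπ ↦ ?_⟩
    obtain ⟨h1, h2⟩ := htan v hv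
    have hre := congrArg Complex.re hπ
    have him := congrArg Complex.im hπ
    simp [coord] at hre him
    rw [Complex.normSq_apply, hh] at hsph
    rw [hh] at h1
    have hv0 : v.2 0 = 0 := by
      apply Complex.ext
      · rw [Complex.zero_re]
        linear_combination (x.2 0).re * h1 - (x.2 0).im * hre - (v.2 0).re * hsph
      · rw [Complex.zero_im]
        linear_combination (x.2 0).im * h1 + (x.2 0).re * hre - (v.2 0).im * hsph
    exact Prod.ext him
      (IsSqrtTower.tangent_eq_zero h2 hv0 fun j hj ↦ absurd hj (hram j))
  · refine ⟨coord 0, fun v hv hπ ↦ ?_⟩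
    obtain ⟨h1, h2⟩ := htan v hv
    have hv2 : v.2 = 0 :=
      IsSqrtTower.tangent_eq_zero h2 hπ fun j hj ↦ absurd hj (hram j)
    refine Prod.ext ?_ hv2
    simpa [hv2, hh] using h1

/-! ### The fibres over the sphere -/

/-- The primitive root of unity `exp (2πi / 2^j)`; each is a square root of the preceding one. -/
noncomputable def dyadicRoot (j : ℕ) : ℂ := Complex.exp (2 * Real.pi * Complex.I / 2 ^ j)

theorem dyadicRoot_zero : dyadicRoot 0 = 1 := by
  simp [dyadicRoot, Complex.exp_two_pi_mul_I]

theorem dyadicRoot_succ_sq (j : ℕ) : dyadicRoot (j + 1) ^ 2 = dyadicRoot j := by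
  rw [dyadicRoot, dyadicRoot, ← Complex.exp_nat_mul]
  congr 1
  field_simp
  ring

theorem dyadicRoot_add_pow (j n : ℕ) : dyadicRoot (j + n) ^ 2 ^ n = dyadicRoot j := by
  induction n with
  | zero => simp
  | succ n ih => rw [pow_succ', pow_mul, ← add_assoc, dyadicRoot_succ_sq, ih]

theorem dyadicRoot_pow_of_le {j n : ℕ} (h : j ≤ n) : dyadicRoot j ^ 2 ^ n = 1 := by
  obtain ⟨d, rfl⟩ := Nat.exists_eq_add_of_le h
  have := dyadicRoot_add_pow 0 j
  rw [zero_add, dyadicRoot_zero] at this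
  rw [pow_add, pow_mul, this, one_pow]

theorem dyadicRoot_succ_pow (j : ℕ) : dyadicRoot (j + 1) ^ 2 ^ j = -1 := by
  rw [add_comm, dyadicRoot_add_pow, dyadicRoot, pow_one, mul_assoc,
    mul_div_cancel_left₀ _ two_ne_zero, Complex.exp_pi_mul_I]

theorem dyadicRoot_ne_zero (j : ℕ) : dyadicRoot j ≠ 0 := Complex.exp_ne_zero _

theorem IsSqrtTower.mul {k : ℕ} {z w : Fin (k + 1) → ℂ} (hz : IsSqrtTower k z) (hw0 : w 0 = 1)
    (hw : ∀ j : Fin k, w j.succ ^ 2 = w j.castSucc) : IsSqrtTower k fun j ↦ w j * z j := by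
  intro j
  simp only [hw0, one_mul]
  rw [mul_pow, hz j, hw j, mul_assoc]

theorem isSqrtTower_dyadicRoot_pow_mul {k : ℕ} {z : Fin (k + 1) → ℂ} (hz : IsSqrtTower k z)
    (n : ℕ) :
    IsSqrtTower k fun j ↦ dyadicRoot j ^ n * z j :=
  hz.mul (by simp [dyadicRoot_zero])
    fun j ↦ by rw [← pow_mul, mul_comm, pow_mul, Fin.val_succ, dyadicRoot_succ_sq]; rfl

/-- The rotation acts transitively on the fibres of the tower. -/
theorem IsSqrtTower.exists_eq_dyadicRoot_pow_mul {k : ℕ} {z w : Fin (k + 1) → ℂ}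
    (hz : IsSqrtTower k z) (hw : IsSqrtTower k w) (h0 : w 0 = z 0) :
    ∃ n : ℕ, ∀ j, w j = dyadicRoot j ^ n * z j := by
  suffices h : ∀ i : Fin (k + 1), ∃ n : ℕ, ∀ j ≤ i, w j = dyadicRoot j ^ n * z j by
    obtain ⟨n, hn⟩ := h (Fin.last k)
    exact ⟨n, fun j ↦ hn j (Fin.le_last j)⟩
  intro i
  induction i using Fin.induction with
  | zero =>
    refine ⟨0, fun j hj ↦ ?_⟩
    rw [Fin.le_zero_iff.1 hj, h0, pow_zero, one_mul]
  | succ i ih =>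
    obtain ⟨n, hn⟩ := ih
    have hsq : w i.succ ^ 2 = (dyadicRoot i.succ ^ n * z i.succ) ^ 2 := by
      rw [isSqrtTower_dyadicRoot_pow_mul hz n i, hw i, hn _ le_rfl]
      simp [dyadicRoot_zero, h0]
    rcases sq_eq_sq_iff_eq_or_eq_neg.1 hsq with h | h
    · refine ⟨n, fun j hj ↦ ?_⟩
      rcases hj.lt_or_eq with hj | rfl
      · exact hn j (Fin.le_castSucc_iff.2 hj)
      · exact h
    -- The power `2 ^ i` of the rotation changes the sign of `z_{i+1}` and fixes the earlier `z_j`.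
    · refine ⟨n + 2 ^ (i : ℕ), fun j hj ↦ ?_⟩
      rcases hj.lt_or_eq with hj | rfl
      · have hj' := Fin.le_castSucc_iff.2 hj
        rw [hn j hj', pow_add, dyadicRoot_pow_of_le (n := i) hj', mul_one]
      · rw [h, pow_add, Fin.val_succ, dyadicRoot_succ_pow]
        ring

/-! ### Lifting radial segments -/

/-- The principal branch of a power with exponent of positive real part is continuous along every
horizontal line. On the real axis this includes the crossing of zero. -/
theorem Complex.continuous_ofReal_sub_cpow (a : ℂ) {y : ℂ} (hy : 0 < y.re) :
    Continuous fun t : ℝ ↦ ((t : ℂ) - a) ^ y := by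
  by_cases ha : a.im = 0
  · obtain ⟨r, rfl⟩ : ∃ r : ℝ, (r : ℂ) = a := ⟨a.re, Complex.ext rfl ha.symm⟩
    have h := (Complex.continuous_ofReal_cpow_const hy).comp (continuous_id.sub continuous_const :
      Continuous fun t : ℝ ↦ t - r)
    simpa [Function.comp_def] using h
  · refine Continuous.cpow (by fun_prop) continuous_const fun t ↦ ?_
    exact Or.inr (by simpa using ha)

/-- An affine path in `ℂ` has continuous square roots, square roots of these, and so on, even if it
passes through zero. -/
theorem exists_continuous_sqrtSequence (u a : ℂ) :
    ∃ s : ℕ → ℝ → ℂ, (∀ n, Continuous (s n)) ∧ (∀ t : ℝ, s 0 t = t * u - a) ∧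
      ∀ n t, s (n + 1) t ^ 2 = s n t := by
  have hroot : ∀ (x : ℂ) (n : ℕ), (x ^ ((1 / 2 ^ (n + 1) : ℝ) : ℂ)) ^ 2 =
      x ^ ((1 / 2 ^ n : ℝ) : ℂ) := by
    intro x n
    rw [← Complex.cpow_nat_mul]
    congr 1
    push_cast
    field_simp
    ring
  by_cases hu : u = 0
  · refine ⟨fun n _ ↦ (-a) ^ ((1 / 2 ^ n : ℝ) : ℂ), fun n ↦ continuous_const, fun t ↦ ?_,
      fun n t ↦ hroot _ n⟩
    simp [hu]
  -- After division by `u` the path is horizontal.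
  · refine ⟨fun n t ↦ u ^ ((1 / 2 ^ n : ℝ) : ℂ) * ((t : ℂ) - a / u) ^ ((1 / 2 ^ n : ℝ) : ℂ),
      fun n ↦ continuous_const.mul (Complex.continuous_ofReal_sub_cpow _ ?_), fun t ↦ ?_,
      fun n t ↦ ?_⟩
    · rw [Complex.ofReal_re]; positivity
    · simp
      field_simp
    · rw [mul_pow, hroot, hroot]

/-- The line `t ↦ t u` lifts to a continuous path in the tower of square roots. -/
theorem exists_continuous_isSqrtTower (k : ℕ) (u : ℂ) :
    ∃ Z : ℝ → Fin (k + 1) → ℂ, Continuous Z ∧ (∀ t, IsSqrtTower k (Z t)) ∧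
      ∀ t, Z t 0 = t * u := by
  obtain ⟨r, hrc, hr0, hr⟩ := exists_continuous_sqrtSequence u 0
  choose s hsc hs0 hs using fun j : ℕ ↦ exists_continuous_sqrtSequence u (branchPoint k j)
  -- `T j 0` is the coordinate `z_j`, and `T j n` is an iterated square root of it.
  let T : ℕ → ℕ → ℝ → ℂ := fun j ↦
    Nat.rec r (fun i T n t ↦ T (n + 1) t * s i (n + 1) t) j
  have hT0 : T 0 = r := rfl
  have hTs : ∀ j n t, T (j + 1) n t = T j (n + 1) t * s j (n + 1) t := fun j n t ↦ rfl
  have hTc : ∀ j n, Continuous (T j n) := by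
    intro j
    induction j with
    | zero => exact hrc
    | succ j ih => exact fun n ↦ (ih (n + 1)).mul (hsc j (n + 1))
  have hTsq : ∀ j n t, T j (n + 1) t ^ 2 = T j n t := by
    intro j
    induction j with
    | zero => exact hr
    | succ j ih => intro n t; rw [hTs, hTs, mul_pow, ih, hs]
  have h0 : ∀ t, T 0 0 t = t * u := fun t ↦ by rw [hT0, hr0, sub_zero]
  refine ⟨fun t j ↦ T j 0 t, continuous_pi fun j ↦ hTc j 0, fun t j ↦ ?_, h0⟩
  simp only [Fin.val_succ, Fin.val_castSucc, Fin.val_zero]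
  rw [hTs, mul_pow, hTsq, hs, hs0, h0]

/-! ### The tower surface is closed and orientable -/

theorem isCompact_towerSurface (k : ℕ) : IsCompact {x | towerMap k x = 0} := by
  refine Metric.isCompact_of_isClosed_isBounded
    (isClosed_eq (contDiff_towerMap k).continuous continuous_const) ?_
  refine (Metric.isBounded_closedBall (x := 0) (r := 2)).subset fun x hx ↦ ?_
  obtain ⟨hsph, hz⟩ := towerMap_eq_zero_iff.1 hx
  have h0 : ‖x.2 0‖ ≤ 1 := by
    rw [Complex.normSq_eq_norm_sq] at hsph
    exact (sq_le_one_iff₀ (norm_nonneg _)).1 (by nlinarith [sq_nonneg x.1])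
  rw [mem_closedBall_zero_iff, Prod.norm_def, max_le_iff]
  refine ⟨?_, (pi_norm_le_iff_of_nonneg zero_le_two).2 (hz.norm_le_two h0)⟩
  have := (sq_le_one_iff_abs_le_one x.1).1 (by linarith [Complex.normSq_nonneg (x.2 0)])
  rw [Real.norm_eq_abs]
  linarith

/-- A point of the tower surface with `h ≥ 0` is joined to the pole `h = 1`, and one with `h ≤ 0` to
the pole `h = -1`. The sign is `s`. -/
theorem exists_isPreconnected_mem_pole {k : ℕ} {x : ℝ × (Fin (k + 1) → ℂ)}
    (hx : towerMap k x = 0) {s : ℝ} (hs : s ^ 2 = 1) (hxs : x.1 = s * |x.1|) :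
    ∃ S ⊆ {x | towerMap k x = 0}, x ∈ S ∧ (s, 0) ∈ S ∧ IsPreconnected S := by
  obtain ⟨hsph, hz⟩ := towerMap_eq_zero_iff.1 hx
  obtain ⟨Z, hZc, hZ, hZ0⟩ := exists_continuous_isSqrtTower k (x.2 0)
  obtain ⟨n, hn⟩ := (hZ 1).exists_eq_dyadicRoot_pow_mul hz (by simp [hZ0])
  let γ : ℝ → ℝ × (Fin (k + 1) → ℂ) := fun t ↦
    (s * √(1 - Complex.normSq (t * x.2 0)), fun j ↦ dyadicRoot j ^ n * Z t j)
  have hγ0 : ∀ t, (γ t).2 0 = t * x.2 0 := fun t ↦ by simp [γ, dyadicRoot_zero, hZ0]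
  have hγ : Continuous γ := by
    refine Continuous.prodMk ?_ (continuous_pi fun j ↦
      continuous_const.mul ((continuous_apply j).comp hZc))
    exact continuous_const.mul (continuous_const.sub
      (Complex.continuous_normSq.comp (by fun_prop))).sqrt
  refine ⟨γ '' Set.Icc 0 1, ?_, ⟨1, by simp, ?_⟩, ⟨0, by simp, ?_⟩,
    isPreconnected_Icc.image γ hγ.continuousOn⟩
  · rintro _ ⟨t, ht, rfl⟩
    refine towerMap_eq_zero_iff.2 ⟨?_, isSqrtTower_dyadicRoot_pow_mul (hZ t) n⟩
    have hle : Complex.normSq (t * x.2 0) ≤ 1 := by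
      rw [Complex.normSq_mul, Complex.normSq_ofReal]
      have h1 : Complex.normSq (x.2 0) ≤ 1 := by nlinarith [sq_nonneg x.1]
      have h2 : t * t ≤ 1 := mul_le_one₀ ht.2 ht.1 ht.2
      exact mul_le_one₀ h2 (Complex.normSq_nonneg _) h1
    rw [hγ0]
    simp only [γ]
    rw [mul_pow, hs, one_mul, Real.sq_sqrt (by linarith)]
    ring
  · refine Prod.ext ?_ (funext fun j ↦ (hn j).symm)
    have : 1 - Complex.normSq (x.2 0) = x.1 ^ 2 := by linarith
    simp [γ, this, Real.sqrt_sq_eq_abs, ← hxs]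
  · have hz0 : (γ 0).2 = 0 :=
      (isSqrtTower_dyadicRoot_pow_mul (hZ 0) n).eq_zero_of_zero (by simp [hZ0])
    refine Prod.ext ?_ hz0
    simp [γ]

/-- The two halves of the surface meet over the equator `h = 0`, whose points are joined to both
poles. -/
theorem isConnected_towerSurface (k : ℕ) : IsConnected {x | towerMap k x = 0} := by
  obtain ⟨Z, -, hZ, hZ0⟩ := exists_continuous_isSqrtTower k 1
  have hb : towerMap k (0, Z 1) = 0 := towerMap_eq_zero_iff.2 ⟨by simp [hZ0], hZ 1⟩
  refine ⟨⟨_, hb⟩, isPreconnected_of_forall (0, Z 1) fun y hy ↦ ?_⟩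
  obtain ⟨s, hs, hys⟩ : ∃ s : ℝ, s ^ 2 = 1 ∧ y.1 = s * |y.1| := by
    rcases le_total 0 y.1 with h | h
    · exact ⟨1, by norm_num, by rw [abs_of_nonneg h, one_mul]⟩
    · exact ⟨-1, by norm_num, by rw [abs_of_nonpos h]; ring⟩
  obtain ⟨S, hS, hyS, hpS, hSc⟩ := exists_isPreconnected_mem_pole hy hs hys
  obtain ⟨S', hS', hbS', hpS', hSc'⟩ := exists_isPreconnected_mem_pole hb hs (by simp)
  exact ⟨S ∪ S', Set.union_subset hS hS', Or.inr hbS', Or.inl hyS, hSc.union _ hpS hpS' hSc'⟩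

theorem isClosedOrientableSurface_towerSurface (k : ℕ) :
    IsClosedOrientableSurface (TowerSurface k) where
  t2 := inferInstance
  compact := isCompact_iff_compactSpace.1 (isCompact_towerSurface k)
  connected := isConnected_iff_connectedSpace.1 (isConnected_towerSurface k)
  exists_orientedAtlas := by
    refine exists_orientedAtlas_levelSet (contDiff_towerMap k) ?_ fun x hx ↦ ?_
    · simp [Module.finrank_prod, Module.finrank_pi_fintype, Complex.finrank_real_complex]
      ring
    · obtain ⟨π, hπ⟩ := towerMap_regular k hx
      let B := Complex.orthonormalBasisOneI.repr.toContinuousLinearEquiv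
      exact ⟨(B : ℂ →L[ℝ] EuclideanSpace ℝ (Fin 2)).comp π,
        fun v hv h ↦ hπ v hv (B.map_eq_zero_iff.1 h)⟩

/-! ### The periodic map and its orbits -/

/-- The periodic map of the tower surface which multiplies `z_j` by `exp (2πi / 2^j)`. -/
noncomputable def towerRotation (k : ℕ) : TowerSurface k ≃ₜ TowerSurface k where
  toFun x := ⟨(x.1.1, fun j ↦ dyadicRoot j * x.1.2 j), by
    obtain ⟨h, hz⟩ := towerMap_eq_zero_iff.1 x.2
    refine towerMap_eq_zero_iff.2 ⟨by simpa [dyadicRoot_zero] using h, ?_⟩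
    simpa using isSqrtTower_dyadicRoot_pow_mul hz 1⟩
  invFun x := ⟨(x.1.1, fun j ↦ (dyadicRoot j)⁻¹ * x.1.2 j), by
    obtain ⟨h, hz⟩ := towerMap_eq_zero_iff.1 x.2
    refine towerMap_eq_zero_iff.2 ⟨by simpa [dyadicRoot_zero] using h, ?_⟩
    refine hz.mul (by simp [dyadicRoot_zero]) fun j ↦ ?_
    rw [inv_pow, Fin.val_succ, dyadicRoot_succ_sq]
    rfl⟩
  left_inv x := by
    refine Subtype.ext (Prod.ext rfl (funext fun j ↦ ?_))
    exact inv_mul_cancel_left₀ (dyadicRoot_ne_zero j) _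
  right_inv x := by
    refine Subtype.ext (Prod.ext rfl (funext fun j ↦ ?_))
    exact mul_inv_cancel_left₀ (dyadicRoot_ne_zero j) _
  continuous_toFun := by fun_prop
  continuous_invFun := by fun_prop

theorem towerRotation_pow_apply (k n : ℕ) (x : TowerSurface k) :
    ((towerRotation k ^ n) x : ℝ × (Fin (k + 1) → ℂ)) =
      (x.1.1, fun j : Fin (k + 1) ↦ dyadicRoot j ^ n * x.1.2 j) := by
  induction n with
  | zero => simp
  | succ n ih =>
    rw [pow_succ', Homeomorph.mul_apply]
    have h1 : ((towerRotation k ^ n) x).1.1 = x.1.1 := by rw [ih]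
    refine Prod.ext h1 (funext fun j ↦ ?_)
    have h2 : ((towerRotation k ^ n) x).1.2 j = dyadicRoot j ^ n * x.1.2 j := by rw [ih]
    change dyadicRoot j * ((towerRotation k ^ n) x).1.2 j = dyadicRoot j ^ (n + 1) * x.1.2 j
    rw [h2, pow_succ', mul_assoc]

theorem isPeriodicMap_towerRotation (k : ℕ) : IsPeriodicMap (towerRotation k) := by
  refine ⟨2 ^ k, by positivity, Homeomorph.ext fun x ↦ Subtype.ext ?_⟩
  rw [towerRotation_pow_apply]
  refine Prod.ext rfl (funext fun j ↦ ?_)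
  change dyadicRoot j ^ 2 ^ k * x.1.2 j = x.1.2 j
  rw [dyadicRoot_pow_of_le (Nat.lt_succ_iff.1 j.2), one_mul]

theorem exists_towerSurface_point_over (k : ℕ) (i : Fin k) :
    ∃ x : TowerSurface k, x.1.2 0 = branchPoint k i := by
  obtain ⟨Z, -, hZ, hZ0⟩ := exists_continuous_isSqrtTower k (branchPoint k i)
  have h0 : Z 1 0 = branchPoint k i := by simp [hZ0]
  refine ⟨⟨(√(1 - Complex.normSq (branchPoint k i)), Z 1),
    towerMap_eq_zero_iff.2 ⟨?_, hZ 1⟩⟩, h0⟩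
  have := normSq_branchPoint_lt_one i.2
  change Complex.normSq (Z 1 0) + √(1 - Complex.normSq (branchPoint k i)) ^ 2 = 1
  rw [h0, Real.sq_sqrt (by linarith)]
  ring

/-- Points over the branch point `c_i` have period `2 ^ i`. -/
theorem towerRotation_pow_eq_self {k : ℕ} {i : Fin k} {x : TowerSurface k}
    (hx : x.1.2 0 = branchPoint k i) : (towerRotation k ^ 2 ^ (i : ℕ)) x = x := by
  have hz := (towerMap_eq_zero_iff.1 x.2).2
  apply Subtype.ext
  rw [towerRotation_pow_apply]
  refine Prod.ext rfl (funext fun j ↦ ?_)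
  change dyadicRoot j ^ 2 ^ (i : ℕ) * x.1.2 j = x.1.2 j
  rcases le_or_gt (j : ℕ) i with h | h
  · rw [dyadicRoot_pow_of_le h, one_mul]
  · rw [hz.eq_zero_of_lt hx h, mul_zero]

/-- Points over the branch point `c_{n+1}` do not have period `2 ^ n`: their coordinate `z_{n+1}` is
nonzero and changes its sign. -/
theorem towerRotation_pow_ne_self {k n : ℕ} {i : Fin k} {x : TowerSurface k}
    (hx : x.1.2 0 = branchPoint k i) (hi : (i : ℕ) = n + 1) : (towerRotation k ^ 2 ^ n) x ≠ x := by
  have hz := (towerMap_eq_zero_iff.1 x.2).2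
  intro h
  have h1 := congrFun (congrArg Prod.snd (congrArg Subtype.val h)) i.castSucc
  rw [towerRotation_pow_apply] at h1
  have h2 : dyadicRoot (n + 1) ^ 2 ^ n * x.1.2 i.castSucc = x.1.2 i.castSucc := by
    rw [← hi]; exact h1
  rw [dyadicRoot_succ_pow, neg_one_mul] at h2
  exact hz.ne_zero_of_le hx (by simp) (self_eq_neg.1 h2.symm)

/-! ### Periods and the dimension of a linearization -/

theorem le_finrank_of_forall_lt_succ {K V : Type*} [DivisionRing K] [AddCommGroup V]
    [Module K V] [FiniteDimensional K V] (S : ℕ → Submodule K V) {n : ℕ}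
    (hS : ∀ i < n, S i < S (i + 1)) : n ≤ Module.finrank K (S n) := by
  induction n with
  | zero => exact Nat.zero_le _
  | succ n ih =>
    exact (ih fun i hi ↦ hS i (hi.trans n.lt_succ_self)).trans_lt
      (Submodule.finrank_lt_finrank_of_lt (hS n n.lt_succ_self))

/-- Points of minimal periods `1, 2, 4, …, 2 ^ n` force an equivariant embedding to have a target of
dimension at least `n`: the fixed spaces of the powers `2 ^ i` of the linear action increase
strictly. -/
theorem IsEquivariantEmbeddingFor.le_of_periods {M : Type*} [TopologicalSpace M] {f : M ≃ₜ M}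
    {m n : ℕ} {e : M → EuclideanSpace ℝ (Fin m)} (he : IsEquivariantEmbeddingFor f e)
    {p : ℕ → M} (hfix : ∀ i ≤ n, (f ^ 2 ^ i) (p i) = p i)
    (hmove : ∀ i < n, (f ^ 2 ^ i) (p (i + 1)) ≠ p (i + 1)) : n ≤ m := by
  obtain ⟨hemb, ρ, hρ⟩ := he
  let g : Subgroup.zpowers f := ⟨f, Subgroup.mem_zpowers f⟩
  let R (i : ℕ) := Matrix.toEuclideanLin (ρ (g ^ 2 ^ i) : Matrix (Fin m) (Fin m) ℝ)
  have hR : ∀ i x, e ((f ^ 2 ^ i) x) = R i (e x) := fun i x ↦ hρ (g ^ 2 ^ i) x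
  have hsq : ∀ i v, R (i + 1) v = R i (R i v) := by
    intro i v
    simp only [R]
    rw [pow_succ, pow_mul, pow_two, map_mul, Submonoid.coe_mul, ← LinearMap.comp_apply]
    congr 1
    exact Matrix.toLpLin_mul_same _ _ _
  let S (i : ℕ) : Submodule ℝ (EuclideanSpace ℝ (Fin m)) := LinearMap.eqLocus (R i) LinearMap.id
  have hS : ∀ i < n, S i < S (i + 1) := by
    intro i hi
    refine SetLike.lt_iff_le_and_exists.2 ⟨fun v hv ↦ ?_, e (p (i + 1)), ?_, ?_⟩
    · have hv' : R i v = v := hv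
      change R (i + 1) v = v
      rw [hsq, hv', hv']
    · change R (i + 1) (e (p (i + 1))) = e (p (i + 1))
      rw [← hR, hfix _ hi]
    · intro h
      have h' : R i (e (p (i + 1))) = e (p (i + 1)) := h
      rw [← hR] at h'
      exact hmove i hi (hemb.injective h')
  have h := (le_finrank_of_forall_lt_succ S hS).trans (Submodule.finrank_le _)
  rwa [finrank_euclideanSpace_fin] at h

theorem corollary1p5 (m : ℕ) (hm : 0 < m) :
    ∃ (F : Type) (_ : TopologicalSpace F) (f : F ≃ₜ F),
      IsClosedOrientableSurface F ∧ IsPeriodicMap f ∧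
        ¬ ∃ e : F → EuclideanSpace ℝ (Fin m), IsEquivariantEmbeddingFor f e := by
  -- The points over the `m + 2` branch points have minimal periods `1, 2, 4, …, 2 ^ (m + 1)`.
  refine ⟨TowerSurface (m + 2), inferInstance, towerRotation (m + 2),
    isClosedOrientableSurface_towerSurface _, isPeriodicMap_towerRotation _, ?_⟩
  rintro ⟨e, he⟩
  choose x hx using exists_towerSurface_point_over (m + 2)
  let p (i : ℕ) : TowerSurface (m + 2) := x (Fin.ofNat (m + 2) i)
  have hp : ∀ i ≤ m + 1, ((Fin.ofNat (m + 2) i : Fin (m + 2)) : ℕ) = i := fun i hi ↦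
    Nat.mod_eq_of_lt (by omega)
  have h : m + 1 ≤ m := he.le_of_periods (p := p)
    (fun i hi ↦ by
      have := towerRotation_pow_eq_self (hx (Fin.ofNat (m + 2) i))
      rwa [hp i hi] at this)
    (fun i hi ↦ towerRotation_pow_ne_self (hx _) (hp _ hi))
  omega
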